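/- **Conventions.** A poset $P$ is *Dedekind complete* if every nonempty subset of $P$ that is bounded above has a least upper bound. For posets $P,Q$, write $Q\le_T P$ if there is a map $\phi:P\to Q$ carrying cofinal subsets of $P$ to cofinal subsets of $Q$; $P\times Q$ carries the coordinatewise order. A topological space $Z$ has a *$P$-base* if every $z\in Z$ has a neighborhood base $(U_p)_{p\in P}$ with $U_p\subseteq U_{p'}$ whenever $p\ge p'$. For a topological space $Z$, $A(Z)$ denotes the free Abelian topological group on $Z$, that is, the free Abelian group on $Z$ with the finest group topology making the canonical map $Z\to A(Z)$ continuous. A subspace $Y\subseteq X$ is a *retract* of $X$ if there is a continuous map $r:X\to Y$ with $r(y)=y$ for all $y\in Y$; $X/Y$ is the quotient space obtained from $X$ by identifying all points of $Y$ with each other. **Theorem.** Let $X$ be a Tychonoff space and $Y$ a retract of $X$. 1. Let $P$, $Q$ and $R$ be Dedekind-complete posets such that $P\times Q\le_T R$. If $A(Y)$ has a $P$-base and $A(X/Y)$ has a $Q$-base, then $A(X)$ has an $R$-base. 2. Let $P$ be a Dedekind-complete directed poset. If both $A(Y)$ and $A(X/Y)$ have a $P$-base, then $A(X)$ has a $P$-base.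 -/

import Mathlib

open Topology Filter

/-- Every nonempty subset that is bounded above has a least upper bound. -/
def IsDedekindComplete (P : Type*) [PartialOrder P] : Prop :=
  ∀ S : Set P, S.Nonempty → BddAbove S → ∃ a, IsLUB S a

/-- `Q ≤_T P`: the poset `Q` is a Tukey quotient of `P`, i.e. some map `P → Q` carries
cofinal subsets of `P` to cofinal subsets of `Q`. -/
def TukeyLE (Q P : Type*) [PartialOrder Q] [PartialOrder P] : Prop :=
  ∃ φ : P → Q, ∀ C : Set P, IsCofinal C → IsCofinal (φ '' C)

/-- `X` has a neighborhood `P`-base at `x`: a neighborhood base `(U p)_{p ∈ P}` at `x`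
with `U p ⊆ U p'` whenever `p' ≤ p`. -/
def HasNhdsPBase (P : Type*) [PartialOrder P] {X : Type*} [TopologicalSpace X] (x : X) : Prop :=
  ∃ U : P → Set X, (∀ p p' : P, p' ≤ p → U p ⊆ U p') ∧ (𝓝 x).HasBasis (fun _ : P => True) U

/-- `X` has a `P`-base: it has a neighborhood `P`-base at each of its points. -/
def HasPBase (P : Type*) [PartialOrder P] (X : Type*) [TopologicalSpace X] : Prop :=
  ∀ x : X, HasNhdsPBase P x

/-- `Y` is a retract of `X`: some continuous map `X → Y` is the identity on `Y`. -/
def IsRetractOf {X : Type*} [TopologicalSpace X] (Y : Set X) : Prop :=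
  ∃ r : X → Y, Continuous r ∧ ∀ y : Y, r y = y

/-- The equivalence relation on `X` that identifies all points of `Y` with each other and
nothing else. -/
def collapseSetoid {X : Type*} (Y : Set X) : Setoid X where
  r x x' := x = x' ∨ (x ∈ Y ∧ x' ∈ Y)
  iseqv :=
    { refl := fun _ => Or.inl rfl
      symm := by
        rintro x y (h | ⟨h, h'⟩)
        · exact Or.inl h.symm
        · exact Or.inr ⟨h', h⟩
      trans := by
        rintro x y z (rfl | ⟨h, h'⟩) (rfl | ⟨k, k'⟩)
        · exact Or.inl rfl
        · exact Or.inr ⟨k, k'⟩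
        · exact Or.inr ⟨h, h'⟩
        · exact Or.inr ⟨h, k'⟩ }

/-- The quotient space `X/Y`, with the quotient topology. -/
abbrev CollapseQuotient {X : Type*} (Y : Set X) : Type _ := Quotient (collapseSetoid Y)

/-- The free Abelian topological group `A(X)`: the free Abelian group on `X` with the finest
group topology that makes the canonical map `X → A(X)` continuous. -/
def FreeAbelianTopGroup (X : Type*) [TopologicalSpace X] : Type _ := FreeAbelianGroup X

namespace FreeAbelianTopGroup

instance (X : Type*) [TopologicalSpace X] : AddCommGroup (FreeAbelianTopGroup X) :=
  inferInstanceAs (AddCommGroup (FreeAbelianGroup X))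

/-- The canonical map `σ : X → A(X)`. -/
def of {X : Type*} [TopologicalSpace X] (x : X) : FreeAbelianTopGroup X := FreeAbelianGroup.of x

/-- The finest group topology on the free Abelian group on `X` for which the canonical map is
continuous. In the lattice of group topologies `t ≤ s` means that `t` is finer than `s`, so it
is an infimum. -/
def groupTopology (X : Type*) [tX : TopologicalSpace X] :
    AddGroupTopology (FreeAbelianTopGroup X) :=
  sInf {t | @Continuous X (FreeAbelianTopGroup X) tX t.toTopologicalSpace of}

instance (X : Type*) [TopologicalSpace X] : TopologicalSpace (FreeAbelianTopGroup X) :=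
  (groupTopology X).toTopologicalSpace

instance (X : Type*) [TopologicalSpace X] : IsTopologicalAddGroup (FreeAbelianTopGroup X) :=
  (groupTopology X).toIsTopologicalAddGroup

/-- The canonical map is continuous. -/
theorem continuous_of {X : Type*} [tX : TopologicalSpace X] :
    Continuous (of : X → FreeAbelianTopGroup X) := by
  refine continuous_sInf_rng.2 ?_
  rintro _ ⟨t, ht, rfl⟩
  exact ht

/-- The image of the canonical map generates the group. -/
theorem closure_range_of (X : Type*) [TopologicalSpace X] :
    AddSubgroup.closure (Set.range (of : X → FreeAbelianTopGroup X)) = ⊤ := by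
  rw [eq_top_iff]
  rintro x -
  exact FreeAbelianGroup.induction_on (motive := fun z : FreeAbelianGroup X =>
      (show FreeAbelianTopGroup X from z) ∈
        AddSubgroup.closure (Set.range (of : X → FreeAbelianTopGroup X))) x
    (zero_mem _) (fun y => AddSubgroup.subset_closure ⟨y, rfl⟩) (fun _ h => neg_mem h)
    (fun _ _ => add_mem)

/-- The universal property. -/
theorem existsUnique_lift {X H : Type*} [tX : TopologicalSpace X] [AddCommGroup H]
    [tH : TopologicalSpace H] [IsTopologicalAddGroup H] (f : X → H) (hf : Continuous f) :
    ∃! F : FreeAbelianTopGroup X →+ H, Continuous F ∧ ∀ x, F (of x) = f x := by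
  let F : FreeAbelianTopGroup X →+ H := FreeAbelianGroup.lift f
  have hF : ∀ x, F (of x) = f x := fun x => FreeAbelianGroup.lift_apply_of f x
  refine ⟨F, ⟨?_, hF⟩, fun G hG => FreeAbelianGroup.lift_ext _ _
    fun x => (hG.2 x).trans (hF x).symm⟩
  let t : AddGroupTopology (FreeAbelianTopGroup X) :=
    { toTopologicalSpace := tH.induced F
      toIsTopologicalAddGroup := topologicalAddGroup_induced F }
  have ht : @Continuous X _ tX t.toTopologicalSpace of := by
    refine continuous_induced_rng.2 ?_
    have : F ∘ of = f := funext hF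
    rwa [this]
  have hle : (groupTopology X).toTopologicalSpace ≤ tH.induced F :=
    sInf_le ⟨t, ht, rfl⟩
  exact continuous_iff_le_induced.2 hle

/-- `A(X)` is Hausdorff as soon as continuous real functions separate the points of `X`. -/
theorem t2Space_of_separating {X : Type*} [TopologicalSpace X]
    (hX : ∀ a b : X, a ≠ b → ∃ f : X → ℝ, Continuous f ∧ f a ≠ f b) :
    T2Space (FreeAbelianTopGroup X) := by
  classical
  suffices h : ∀ x : FreeAbelianTopGroup X, x ≠ 0 →
      ∃ F : FreeAbelianTopGroup X →+ ℝ, Continuous F ∧ F x ≠ 0 by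
    refine T2Space.mk fun x y hxy => ?_
    obtain ⟨F, hF, hne⟩ := h (x - y) (sub_ne_zero.2 hxy)
    exact separated_by_continuous hF (by rwa [map_sub, sub_ne_zero] at hne)
  intro x hx
  let v : X →₀ ℤ := FreeAbelianGroup.toFinsupp x
  have hv : v ≠ 0 := fun h => hx ((FreeAbelianGroup.equivFinsupp X).injective
    (h.trans (map_zero (FreeAbelianGroup.equivFinsupp X)).symm))
  obtain ⟨a, ha⟩ := Finsupp.support_nonempty_iff.2 hv
  have hex : ∀ b : X, ∃ f : X → ℝ, Continuous f ∧ f b = 0 ∧ (a ≠ b → f a ≠ 0) := by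
    intro b
    by_cases hab : a = b
    · exact ⟨fun _ => 0, continuous_const, rfl, fun h => absurd hab h⟩
    · obtain ⟨f, hf, hne⟩ := hX a b hab
      exact ⟨fun t => f t - f b, hf.sub continuous_const, sub_self _, fun _ => sub_ne_zero.2 hne⟩
  choose f hfc hf0 hfa using hex
  let g : X → ℝ := fun t => ∏ b ∈ v.support.erase a, f b t
  have hg : Continuous g := continuous_finsetProd _ fun b _ => hfc b
  obtain ⟨F, ⟨hFc, hF⟩, -⟩ := existsUnique_lift g hg
  refine ⟨F, hFc, ?_⟩
  have hsum : F x = v.sum fun c n => n • g c := by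
    have h : F = (Finsupp.liftAddHom fun c => (zmultiplesHom ℝ) (g c)).comp
        (FreeAbelianGroup.toFinsupp (X := X)) := by
      refine FreeAbelianGroup.lift_ext _ _ fun c => ?_
      refine (hF c).trans ?_
      simp
    have h' := DFunLike.congr_fun h x
    rw [h']
    change Finsupp.liftAddHom (fun c => (zmultiplesHom ℝ) (g c)) v = _
    simp [Finsupp.sum]
  rw [hsum, Finsupp.sum, Finset.sum_eq_single a]
  · refine smul_ne_zero (Finsupp.mem_support_iff.1 ha) (Finset.prod_ne_zero_iff.2 fun b hb => ?_)
    exact hfa b (Finset.ne_of_mem_erase hb).symm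
  · intro b hb hba
    have : g b = 0 := Finset.prod_eq_zero (Finset.mem_erase.2 ⟨hba, hb⟩) (hf0 b)
    rw [this, smul_zero]
  · exact fun h => absurd ha h

/-- `A(X)` is Hausdorff for every Tychonoff space `X`. -/
instance (X : Type*) [TopologicalSpace X] [T35Space X] : T2Space (FreeAbelianTopGroup X) := by
  refine t2Space_of_separating fun a b hab => ?_
  obtain ⟨f, hf, h0, h1⟩ := CompletelyRegularSpace.completely_regular a {b} isClosed_singleton hab
  refine ⟨fun t => f t, by fun_prop, ?_⟩
  simp [h0, h1 rfl]

/-- `A(X/Y)` is Hausdorff for every closed subspace `Y` of a Tychonoff space `X`, although the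
space `X/Y` itself need not be Tychonoff. -/
theorem t2Space_collapseQuotient {X : Type*} [TopologicalSpace X] [T35Space X] {Y : Set X}
    (hY : IsClosed Y) : T2Space (FreeAbelianTopGroup (CollapseQuotient Y)) := by
  have key : ∀ a b : X, a ∉ Y → a ≠ b → ∃ f : CollapseQuotient Y → ℝ, Continuous f ∧
      f (Quotient.mk _ a) ≠ f (Quotient.mk _ b) := by
    intro a b ha hab
    obtain ⟨f, hf, h0, h1⟩ := CompletelyRegularSpace.completely_regular a (Y ∪ {b})
      (hY.union isClosed_singleton) (by simp [ha, hab])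
    have hr : ∀ s t : X, (collapseSetoid Y) s t → (f s : ℝ) = f t := by
      rintro s t (rfl | ⟨hs, ht⟩)
      · rfl
      · rw [h1 (Or.inl hs), h1 (Or.inl ht)]; rfl
    refine ⟨Quotient.lift (fun t => (f t : ℝ)) hr, Continuous.quotient_lift (by fun_prop) hr, ?_⟩
    change (f a : ℝ) ≠ f b
    rw [h0, h1 (Or.inr rfl)]
    simp
  refine t2Space_of_separating fun p q => Quotient.inductionOn₂ p q fun a b hab => ?_
  have hne : a ≠ b := fun h => hab (by rw [h])
  by_cases ha : a ∈ Y
  · by_cases hb : b ∈ Y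
    · exact absurd (Quotient.sound (s := collapseSetoid Y) (Or.inr ⟨ha, hb⟩)) hab
    · obtain ⟨f, hf, h⟩ := key b a hb hne.symm
      exact ⟨f, hf, h.symm⟩
  · exact key a b ha hne

end FreeAbelianTopGroup

/-! The retraction `r` splits the free group. The homomorphism `A(X) → A(Y) × A(X/Y)` with `x ↦ (r
x, [x])` has the continuous left inverse induced by `y ↦ y` and `[x] ↦ x - r x`, so it is a
topological embedding. The product of a `P`-base and a `Q`-base is a `P × Q`-base, which pulls back
along the embedding to `A(X)` and is reindexed by `R` along the Tukey quotient. For a directed `P`,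
the diagonal shows `P × P ≤_T P`, which gives the second part. -/

/-- A map carrying cofinal sets to cofinal sets is eventually above every element. -/
theorem TukeyLE.exists_forall_ge {Q P : Type*} [PartialOrder Q] [PartialOrder P]
    (h : TukeyLE Q P) : ∃ (φ : P → Q) (ψ : Q → P), ∀ q p, ψ q ≤ p → q ≤ φ p := by
  obtain ⟨φ, hφ⟩ := h
  have key : ∀ q, ∃ p₀, ∀ p, p₀ ≤ p → q ≤ φ p := by
    intro q
    by_contra! hq
    -- If no `p₀` works for `q`, the `p` with `¬ q ≤ φ p` form a cofinal set whose image has no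
    -- element above `q`.
    have hC : IsCofinal {p | ¬ q ≤ φ p} := fun p₀ =>
      let ⟨p, hp, hn⟩ := hq p₀
      ⟨p, hn, hp⟩
    obtain ⟨_, ⟨p, hp, rfl⟩, hle⟩ := hφ _ hC q
    exact hp hle
  choose ψ hψ using key
  exact ⟨φ, ψ, hψ⟩

/-- The square of a directed poset is a Tukey quotient of the poset. -/
theorem tukeyLE_prod_self (P : Type*) [PartialOrder P] [IsDirectedOrder P] :
    TukeyLE (P × P) P := by
  refine ⟨fun p => (p, p), fun C hC ⟨a, b⟩ => ?_⟩
  obtain ⟨c, hac, hbc⟩ := exists_ge_ge a b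
  obtain ⟨d, hd, hcd⟩ := hC c
  exact ⟨(d, d), ⟨d, hd, rfl⟩, hac.trans hcd, hbc.trans hcd⟩

section PBase

variable {P Q Z W : Type*} [PartialOrder P] [PartialOrder Q] [TopologicalSpace Z]
  [TopologicalSpace W]

/-- As `φ` need not be monotone, `U (φ p)` may fail to decrease in `p`. Intersecting all `U q` with
`ψ q ≤ p` forces monotonicity, and the result is still a neighborhood because it contains `U (φ p)`.
-/
theorem HasNhdsPBase.of_tukeyLE {z : Z} (hz : HasNhdsPBase Q z) (h : TukeyLE Q P) :
    HasNhdsPBase P z := by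
  obtain ⟨U, hU, hb⟩ := hz
  obtain ⟨φ, ψ, hψ⟩ := h.exists_forall_ge
  refine ⟨fun p => ⋂ q ∈ {q | ψ q ≤ p}, U q, fun p p' hp => ?_, ⟨fun t => ?_⟩⟩
  · exact Set.biInter_subset_biInter_left fun q hq => le_trans hq hp
  · constructor
    · intro ht
      obtain ⟨q, -, hq⟩ := hb.mem_iff.1 ht
      -- At `p = ψ q` the set `U q` is itself one of those intersected.
      exact ⟨ψ q, trivial, (Set.iInter₂_subset q (le_refl (ψ q))).trans hq⟩
    · rintro ⟨p, -, hp⟩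
      exact mem_of_superset (hb.mem_of_mem (i := φ p) trivial)
        ((Set.subset_iInter₂ fun q hq => hU _ _ (hψ q p hq)).trans hp)

theorem HasPBase.of_tukeyLE (hZ : HasPBase Q Z) (h : TukeyLE Q P) : HasPBase P Z :=
  fun z => (hZ z).of_tukeyLE h

theorem HasPBase.prod (hZ : HasPBase P Z) (hW : HasPBase Q W) : HasPBase (P × Q) (Z × W) := by
  rintro ⟨z, w⟩
  obtain ⟨U, hU, hUb⟩ := hZ z
  obtain ⟨V, hV, hVb⟩ := hW w
  refine ⟨fun i => U i.1 ×ˢ V i.2,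
    fun i j hij => Set.prod_mono (hU _ _ hij.1) (hV _ _ hij.2), ?_⟩
  simpa using hUb.prod_nhds hVb

theorem Topology.IsInducing.hasPBase {f : Z → W} (hf : IsInducing f) (hW : HasPBase P W) :
    HasPBase P Z := by
  intro z
  obtain ⟨U, hU, hb⟩ := hW (f z)
  refine ⟨fun p => f ⁻¹' U p, fun p p' hp => Set.preimage_mono (hU p p' hp), ?_⟩
  rw [hf.nhds_eq_comap]
  exact hb.comap f

end PBase

namespace FreeAbelianTopGroup

/-- If `Y` is a retract of `X`, then `A(X)` embeds in `A(Y) × A(X/Y)`. -/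
theorem exists_isInducing_prod {X : Type*} [TopologicalSpace X] {Y : Set X}
    (hY : IsRetractOf Y) :
    ∃ f : FreeAbelianTopGroup X →
      FreeAbelianTopGroup Y × FreeAbelianTopGroup (CollapseQuotient Y), IsInducing f := by
  obtain ⟨r, hr, hrY⟩ := hY
  obtain ⟨F, ⟨hFc, hF⟩, -⟩ := existsUnique_lift
    (fun x : X => ((of (r x), of (Quotient.mk _ x)) :
      FreeAbelianTopGroup Y × FreeAbelianTopGroup (CollapseQuotient Y)))
    ((continuous_of.comp hr).prodMk (continuous_of.comp continuous_quotient_mk'))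
  obtain ⟨G, ⟨hGc, hG⟩, -⟩ := existsUnique_lift
    (fun y : Y => (of (y : X) : FreeAbelianTopGroup X)) (continuous_of.comp continuous_subtype_val)
  -- The map `x ↦ x - r x` vanishes on `Y`, hence factors through `X/Y`.
  have hd : ∀ s t : X, collapseSetoid Y s t →
      (of s - of (r s : X) : FreeAbelianTopGroup X) = of t - of (r t : X) := by
    rintro s t (rfl | ⟨hs, ht⟩)
    · rfl
    · rw [hrY ⟨s, hs⟩, hrY ⟨t, ht⟩, sub_self, sub_self]
  obtain ⟨H, ⟨hHc, hH⟩, -⟩ := existsUnique_lift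
    (Quotient.lift (fun s : X => (of s - of (r s : X) : FreeAbelianTopGroup X)) hd)
    (Continuous.quotient_lift (continuous_of.sub
      (continuous_of.comp (continuous_subtype_val.comp hr))) hd)
  obtain ⟨I, -, hI⟩ := existsUnique_lift (of : X → FreeAbelianTopGroup X) continuous_of
  have hGF : Continuous (G.coprod H) :=
    (hGc.comp continuous_fst).add (hHc.comp continuous_snd)
  -- Both sides are continuous homomorphisms fixing the generators, since `r x + (x - r x) = x`;
  -- uniqueness in the universal property identifies them.
  have hid : (G.coprod H).comp F = AddMonoidHom.id _ := by
    rw [hI (AddMonoidHom.id _) ⟨continuous_id, fun _ => rfl⟩]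
    refine hI _ ⟨hGF.comp hFc, fun x => ?_⟩
    rw [AddMonoidHom.comp_apply, hF, AddMonoidHom.coprod_apply, hG, hH]
    exact add_sub_cancel _ _
  -- A continuous map with a continuous left inverse is inducing.
  refine ⟨F, IsInducing.of_comp hFc hGF ?_⟩
  rw [← AddMonoidHom.coe_comp, hid]
  exact IsInducing.id

end FreeAbelianTopGroup

theorem mainTheorem5 {X : Type*} [TopologicalSpace X] [T35Space X] (Y : Set X)
    (hY : IsRetractOf Y) :
    (∀ (P Q R : Type*) [PartialOrder P] [PartialOrder Q] [PartialOrder R],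
      IsDedekindComplete P → IsDedekindComplete Q → IsDedekindComplete R →
      TukeyLE (P × Q) R →
      HasPBase P (FreeAbelianTopGroup Y) →
      HasPBase Q (FreeAbelianTopGroup (CollapseQuotient Y)) →
      HasPBase R (FreeAbelianTopGroup X)) ∧
    (∀ (P : Type*) [PartialOrder P] [IsDirectedOrder P],
      IsDedekindComplete P →
      HasPBase P (FreeAbelianTopGroup Y) →
      HasPBase P (FreeAbelianTopGroup (CollapseQuotient Y)) →
      HasPBase P (FreeAbelianTopGroup X)) := by
  obtain ⟨f, hf⟩ := FreeAbelianTopGroup.exists_isInducing_prod hY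
  exact ⟨fun P Q R _ _ _ _ _ _ h hP hQ => (hf.hasPBase (hP.prod hQ)).of_tukeyLE h,
    fun P _ _ _ hP hQ => (hf.hasPBase (hP.prod hQ)).of_tukeyLE (tukeyLE_prod_self P)⟩
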